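/- Let $X$ be a complex manifold (Hausdorff, second countable) and let $\Omega\subsetneq X$ be a domain, i.e. a nonempty connected open subset. Suppose that $\Omega$ is Kobayashi hyperbolic, i.e. that its Kobayashi pseudodistance $\mathsf k=\mathsf k_\Omega$ (the infimum of the total Poincaré lengths of finite chains of holomorphic discs in $\Omega$ joining two points) is a distance. *Metric compactification.* Let $C_*(\Omega)$ be the space of real continuous functions on $(\Omega,\mathsf k)$ modulo constants, with the quotient of the topology of locally uniform convergence. Let $i_{\mathsf k}:\Omega\to C_*(\Omega)$, $i_{\mathsf k}(x)=[\mathsf k(x,\cdot)]$, and let $\overline\Omega^{\mathsf k}$ be the closure of $i_{\mathsf k}(\Omega)$ in $C_*(\Omega)$. *End compactification.* Let $\overline\Omega$ be the closure of $\Omega$ in $X$ and fix an exhaustion of $\overline\Omega$ by compact sets $K_j$, with $K_j\subset\operatorname{int}K_{j+1}$ (interior in $\overline\Omega$). An end of $\overline\Omega$ is a sequence $(F_j)_j$, where $F_j$ is a connected component of $\overline\Omega\setminus K_j$ and $F_{j+1}\subset F_j$ for all $j$. Let $\overline\Omega^{\rm End}$ be the disjoint union of $\overline\Omega$ and the set of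 its ends. A set $U\subset\overline\Omega^{\rm End}$ is open if $U\cap\overline\Omega$ is open in $\overline\Omega$ and if for every end $e=(F_j)_j$ in $U$ there is a $j$ such that $U$ contains $F_j$ and all ends $(G_\nu)_\nu$ with $G_\nu=F_\nu$ for all $\nu\le j$. Let $i_\Omega:\Omega\to\overline\Omega^{\rm End}$ be the inclusion and $\partial\overline\Omega^{\rm End}:=\overline\Omega^{\rm End}\setminus\Omega$. Assume that $\overline\Omega^{\rm End}$ is sequentially compact. *Fibers.* For $x\in\partial\overline\Omega^{\rm End}$ let $$\mathscr H(x):=\{\xi\in\overline\Omega^{\mathsf k}\setminus i_{\mathsf k}(\Omega): \text{there is a sequence } (x_n)\subset\Omega \text{ with } x_n\to x \text{ in } \overline\Omega^{\rm End} \text{ and } i_{\mathsf k}(x_n)\to\xi \text{ in } \overline\Omega^{\mathsf k}\}.$$ **Theorem.** There exists a continuous surjective map $F:\overline\Omega^{\mathsf k}\to\overline\Omega^{\rm End}$ with $F\circ i_{\mathsf k}=i_\Omega$ on $\Omega$ if and only if $\mathscr H(x)\cap\mathscr H(y)=\emptyset$ for all $x\ne y$ in $\partial\overline\Omega^{\rm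 End}$. -/

import Mathlib

open Set Filter Topology
open scoped Manifold ContDiff ComplexConjugate

noncomputable section

/-! ### The Kobayashi distance -/

section Kobayashi

/-- The Poincaré distance of the unit disc: the artanh of the pseudo-hyperbolic distance. -/
def poincareDist (a b : ℂ) : ℝ :=
  Real.artanh ‖(a - b) / (1 - conj a * b)‖

variable (E : Type*) [NormedAddCommGroup E] [NormedSpace ℂ E]
variable {M : Type*} [TopologicalSpace M] [ChartedSpace E M]

/-- `DiscChain E x y r`: there is a finite chain of holomorphic discs in the complex manifold `M`
from `x` to `y`, whose total Poincaré length is `r`. Each link of the chain is a holomorphic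
map `f` from the unit disc to `M` with two marked points `a`, `b` of the disc; it leads from
`f a` to `f b` and has length `poincareDist a b`. -/
inductive DiscChain : M → M → ℝ → Prop
  | nil (x : M) : DiscChain x x 0
  | cons {x y z : M} {r : ℝ} (f : ℂ → M) (a b : ℂ)
      (hf : MDifferentiableOn 𝓘(ℂ, ℂ) 𝓘(ℂ, E) f (Metric.ball (0 : ℂ) 1))
      (ha : a ∈ Metric.ball (0 : ℂ) 1) (hb : b ∈ Metric.ball (0 : ℂ) 1)
      (hx : f a = x) (hy : f b = y) (h : DiscChain y z r) :
      DiscChain x z (poincareDist a b + r)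

/-- The Kobayashi pseudodistance of a connected complex manifold: the infimum of the lengths of
the chains of holomorphic discs from `x` to `y`. (Such chains exist by connectedness, see
`DiscChain.exists_of_connected`.) -/
def kobayashiDist (x y : M) : ℝ :=
  sInf {r : ℝ | DiscChain E x y r}

variable (M) in
/-- A connected complex manifold is Kobayashi hyperbolic if its Kobayashi pseudodistance
separates points. -/
def KobayashiHyperbolic : Prop :=
  ∀ x y : M, kobayashiDist E x y = 0 → x = y

theorem poincareDist_nonneg (a b : ℂ) : 0 ≤ poincareDist a b :=
  Real.artanh_nonneg (norm_nonneg _)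

theorem poincareDist_comm (a b : ℂ) : poincareDist a b = poincareDist b a := by
  unfold poincareDist
  congr 1
  rw [norm_div, norm_div, norm_sub_rev a b]
  congr 1
  rw [← Complex.norm_conj (1 - conj a * b)]
  congr 1
  simp [mul_comm]

variable {E}

theorem DiscChain.nonneg {x y : M} {r : ℝ} (h : DiscChain E x y r) : 0 ≤ r := by
  induction h with
  | nil x => exact le_rfl
  | cons f a b _ _ _ _ _ _ ih => exact add_nonneg (poincareDist_nonneg a b) ih

theorem DiscChain.trans {x y z : M} {r s : ℝ} (h : DiscChain E x y r) (h' : DiscChain E y z s) :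
    DiscChain E x z (r + s) := by
  induction h with
  | nil x => simpa using h'
  | cons f a b hf ha hb hx hy _ ih =>
    rw [add_assoc]
    exact .cons f a b hf ha hb hx hy (ih h')

theorem DiscChain.symm {x y : M} {r : ℝ} (h : DiscChain E x y r) : DiscChain E y x r := by
  induction h with
  | nil x => exact .nil x
  | cons f a b hf ha hb hx hy _ ih =>
    have h1 := DiscChain.cons f b a hf hb ha hy hx (.nil _)
    rw [add_zero, poincareDist_comm b a] at h1
    rw [add_comm]
    exact ih.trans h1

/-- Any two points of a connected complex manifold are joined by a chain of holomorphic discs. -/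
theorem DiscChain.exists_of_connected [IsManifold 𝓘(ℂ, E) ω M] [ConnectedSpace M] (x y : M) :
    ∃ r, DiscChain E x y r := by
  have : IsManifold 𝓘(ℂ, E) 1 M := .of_le (n := ω) le_top
  have key : ∀ p : M, ∀ᶠ q in 𝓝 p, ∃ r, DiscChain E p q r := by
    intro p
    set e := chartAt E p with he
    have hp : p ∈ e.source := mem_chart_source E p
    have ht : e.target ∈ 𝓝 (e p) := e.open_target.mem_nhds (e.map_source hp)
    obtain ⟨R, hR, hRt⟩ := Metric.mem_nhds_iff.1 ht
    have hnear : ∀ᶠ q in 𝓝 p, e q ∈ Metric.ball (e p) (R / 2) :=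
      (e.continuousAt hp).eventually (Metric.ball_mem_nhds _ (half_pos hR))
    filter_upwards [hnear, e.open_source.mem_nhds hp] with q hq hqs
    set g : ℂ → E := fun t => e p + (2 * t) • (e q - e p) with hg
    have hgball : ∀ t ∈ Metric.ball (0 : ℂ) 1, g t ∈ e.target := by
      intro t htt
      apply hRt
      rw [mem_ball_iff_norm] at hq ⊢
      simp only [Metric.mem_ball, dist_zero_right] at htt
      simp only [hg, add_sub_cancel_left, norm_smul, norm_mul, Complex.norm_ofNat]
      nlinarith [norm_nonneg t, norm_nonneg (e q - e p)]
    have hgd : MDifferentiable 𝓘(ℂ, ℂ) 𝓘(ℂ, E) g := by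
      rw [mdifferentiable_iff_differentiable]
      fun_prop
    refine ⟨poincareDist 0 (1 / 2) + 0, .cons (fun t => e.symm (g t)) 0 (1 / 2) ?_ (by simp)
      (by simp; norm_num) (by simp [hg, e.left_inv hp]) (by simp [hg, e.left_inv hqs]) (.nil _)⟩
    exact (mdifferentiableOn_atlas_symm (chart_mem_atlas E p)).comp hgd.mdifferentiableOn hgball
  have hopen : IsClopen {z : M | ∃ r, DiscChain E x z r} := by
    constructor
    · rw [← isOpen_compl_iff, isOpen_iff_mem_nhds]
      intro p hp
      filter_upwards [key p] with q ⟨s, hs⟩ ⟨r, hr⟩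
      exact hp ⟨r + s, hr.trans hs.symm⟩
    · rw [isOpen_iff_mem_nhds]
      rintro p ⟨r, hr⟩
      filter_upwards [key p] with q ⟨s, hs⟩
      exact ⟨r + s, hr.trans hs⟩
  have huniv := hopen.eq_univ ⟨x, 0, .nil x⟩
  exact huniv.ge (mem_univ y)

theorem kobayashiDist_le {x y : M} {r : ℝ} (h : DiscChain E x y r) : kobayashiDist E x y ≤ r :=
  csInf_le ⟨0, fun _ hs => hs.nonneg⟩ h

/-- The points of a Kobayashi hyperbolic connected complex manifold `M`, seen as a metric space
for the Kobayashi distance. -/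
def KobayashiSpace (_ : KobayashiHyperbolic E M) : Type _ := M

/-- The identity map from the manifold to the metric space of its points. -/
def toKobayashi (h : KobayashiHyperbolic E M) (x : M) : KobayashiSpace h := x

instance [IsManifold 𝓘(ℂ, E) ω M] [ConnectedSpace M] (h : KobayashiHyperbolic E M) :
    MetricSpace (KobayashiSpace h) where
  dist x y := kobayashiDist (M := M) E x y
  dist_self x := le_antisymm (kobayashiDist_le (DiscChain.nil (M := M) x))
    (Real.sInf_nonneg fun _ hr => hr.nonneg)
  dist_comm x y := by
    change sInf _ = sInf _
    congr 1
    ext r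
    exact ⟨DiscChain.symm, DiscChain.symm⟩
  dist_triangle x y z := by
    obtain ⟨a, ha⟩ := DiscChain.exists_of_connected (E := E) (M := M) x y
    obtain ⟨b, hb⟩ := DiscChain.exists_of_connected (E := E) (M := M) y z
    refine le_of_forall_pos_lt_add fun ε hε => ?_
    obtain ⟨r, hr, hr'⟩ := Real.lt_sInf_add_pos (s := {r | DiscChain (M := M) E x y r})
      ⟨a, ha⟩ (half_pos hε)
    obtain ⟨s, hs, hs'⟩ := Real.lt_sInf_add_pos (s := {r | DiscChain (M := M) E y z r})
      ⟨b, hb⟩ (half_pos hε)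
    have := kobayashiDist_le (DiscChain.trans hr hs)
    unfold kobayashiDist at this ⊢
    linarith
  eq_of_dist_eq_zero := fun {x y} hxy => h x y hxy

end Kobayashi

/-! ### The metric compactification -/

section MetricCompactification

variable (X : Type*) [MetricSpace X]

/-- The constant functions, as a subspace of `C(X, ℝ)`. -/
def constFunctions : Submodule ℝ C(X, ℝ) where
  carrier := {f | ∃ c : ℝ, f = ContinuousMap.const X c}
  add_mem' := by
    rintro _ _ ⟨c, rfl⟩ ⟨d, rfl⟩
    exact ⟨c + d, rfl⟩
  zero_mem' := ⟨0, rfl⟩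
  smul_mem' := by
    rintro a _ ⟨c, rfl⟩
    exact ⟨a * c, rfl⟩

/-- The space of real continuous functions modulo constants, with the quotient of the
compact-open topology (the topology of locally uniform convergence, for locally compact `X`). -/
abbrev FunctionsModConst : Type _ := C(X, ℝ) ⧸ constFunctions X

variable {X} in
/-- The class of the function `z ↦ d(x, z)` modulo constants. -/
def distClass (x : X) : FunctionsModConst X :=
  Submodule.Quotient.mk ⟨fun z => dist x z, by fun_prop⟩

/-- The metric compactification: the closure of the image of `distClass`, with the subspace
topology. -/
abbrev MetricCompactification : Type _ :=
  closure (range (distClass : X → FunctionsModConst X))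

variable {X} in
/-- The canonical map of `X` into its metric compactification. -/
def metricEmbedding (x : X) : MetricCompactification X :=
  ⟨distClass x, subset_closure (mem_range_self x)⟩

/-- The metric boundary. -/
def metricBoundary : Set (MetricCompactification X) :=
  (range (metricEmbedding : X → MetricCompactification X))ᶜ

end MetricCompactification

/-! ### The end compactification -/

section EndCompactification

variable {C : Type*} [TopologicalSpace C]

/-- An end of `C`, with respect to an exhaustion of `C` by compact sets `K j`: a decreasing
sequence of connected components `component j` of the complements `C \ K j`. -/
structure TopEnd (K : CompactExhaustion C) where
  component : ℕ → Set C
  isComponent : ∀ j, ∃ x ∈ (K j)ᶜ, component j = connectedComponentIn (K j)ᶜ x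
  antitone : ∀ j, component (j + 1) ⊆ component j

/-- The points of the end compactification of `C`: the points of `C` and the ends of `C`. -/
inductive EndCompactification (K : CompactExhaustion C) : Type _
  | point (x : C) : EndCompactification K
  | atEnd (e : TopEnd K) : EndCompactification K

/-- The `j`-th basic neighbourhood of the end `e`: the points of its `j`-th component, and the
ends whose components with index at most `j` are those of `e`. -/
def TopEnd.basicNhd {K : CompactExhaustion C} (e : TopEnd K) (j : ℕ) :
    Set (EndCompactification K) :=
  EndCompactification.point '' e.component j ∪
    EndCompactification.atEnd '' {f | ∀ i ≤ j, f.component i = e.component i}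

/-- The filter of the prescribed neighbourhoods of a point of the end compactification: for
`x ∈ C`, the neighbourhoods of `x` in `C`; for an end, the sets containing one of its basic
neighbourhoods. -/
def EndCompactification.nhdFilter {K : CompactExhaustion C} :
    EndCompactification K → Filter (EndCompactification K)
  | .point x => Filter.map EndCompactification.point (𝓝 x)
  | .atEnd e => ⨅ j, 𝓟 (e.basicNhd j)

/-- The topology of the end compactification: a set is open if it is a prescribed neighbourhood
of each of its points. -/
instance (K : CompactExhaustion C) : TopologicalSpace (EndCompactification K) :=
  TopologicalSpace.mkOfNhds EndCompactification.nhdFilter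

end EndCompactification

/-! ### Domains in a complex manifold -/

section Domain

variable {X : Type*} [TopologicalSpace X] {Ω : TopologicalSpace.Opens X}

/-- The inclusion of `Ω` into the end compactification of its closure in `X`. -/
def endInclusion (K : CompactExhaustion (closure (Ω : Set X))) (z : Ω) : EndCompactification K :=
  .point ⟨(z : X), subset_closure z.2⟩

/-- The boundary of `Ω` in the end compactification of its closure. -/
def endBoundary (K : CompactExhaustion (closure (Ω : Set X))) : Set (EndCompactification K) :=
  (range (endInclusion K))ᶜ

variable {E : Type*} [NormedAddCommGroup E] [NormedSpace ℂ E] [ChartedSpace E X]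
  [IsManifold 𝓘(ℂ, E) ω X] [ConnectedSpace Ω]

/-- The canonical map of a Kobayashi hyperbolic domain into its metric compactification for the
Kobayashi distance. -/
def kobayashiEmbedding (hyp : KobayashiHyperbolic E Ω) (z : Ω) :
    MetricCompactification (KobayashiSpace hyp) :=
  metricEmbedding (toKobayashi hyp z)

/-- The fiber over `x`: the metric boundary points `ξ` such that some sequence of points of `Ω`
converges to `x` in the end compactification and to `ξ` in the metric compactification. -/
def metricFiber (hyp : KobayashiHyperbolic E Ω) (K : CompactExhaustion (closure (Ω : Set X)))
    (x : EndCompactification K) : Set (MetricCompactification (KobayashiSpace hyp)) :=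
  {ξ | ξ ∈ metricBoundary (KobayashiSpace hyp) ∧
    ∃ u : ℕ → Ω, Tendsto (fun n => endInclusion K (u n)) atTop (𝓝 x) ∧
      Tendsto (fun n => kobayashiEmbedding hyp (u n)) atTop (𝓝 ξ)}

end Domain

end

/-! ### Sequences in the end compactification -/

section Ends

variable {C : Type*} [TopologicalSpace C] {K : CompactExhaustion C}

namespace TopEnd

/-! If $F$ exists, a sequence in $\Omega$ converging in both compactifications to $\xi$ and $x$ has
$F(\xi)=x$, so fibers are disjoint. Conversely, define $F(\xi)$ as the limit in the end
compactification of any sequence of $\Omega$ tending to $\xi$. Sequential compactness provides such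
a limit, and disjointness of the fibers makes it independent of the sequence.

This argument, `exists_continuous_surjective_iff_disjoint_fibers`, needs two inputs. On the end
side, components of $\overline\Omega\setminus K_j$ need not be open, so the proof uses limits of
sequences only: they are unique (`tendsto_point_unique`), satisfy a form of regularity
(`exists_subset_forall_tendsto`), and reach every end from $\Omega$ (`exists_seq_tendsto_of_dense`).

On the metric side, Arzelà–Ascoli gives compactness, and separability gives metrizability. The
geometric point is that $\Omega$ with its manifold topology embeds
(`isEmbedding_metricEmbedding_toKobayashi`), without completeness. A nearly shortest chain of discs
from a far point to $x$ crosses the compact frontier of a neighbourhood of $x$, at a point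
definitely closer to the start than $x$ is; this persists in the limit and keeps far points away
from $x$ in the compactification. -/

theorem component_antitone (e : TopEnd K) : Antitone e.component :=
  antitone_nat_of_succ_le e.antitone

theorem component_subset_compl (e : TopEnd K) (j : ℕ) : e.component j ⊆ (K j)ᶜ := by
  obtain ⟨x, -, hx⟩ := e.isComponent j
  exact hx ▸ connectedComponentIn_subset _ _

theorem component_nonempty (e : TopEnd K) (j : ℕ) : (e.component j).Nonempty := by
  obtain ⟨x, hx, h⟩ := e.isComponent j
  exact ⟨x, h ▸ mem_connectedComponentIn hx⟩

theorem component_eq_of_mem (e : TopEnd K) {j : ℕ} {x : C} (hx : x ∈ e.component j) :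
    e.component j = connectedComponentIn (K j)ᶜ x := by
  obtain ⟨y, -, h⟩ := e.isComponent j
  rw [h] at hx ⊢
  exact connectedComponentIn_eq hx

theorem component_eq_of_mem_of_mem {e f : TopEnd K} {j : ℕ} {x : C} (he : x ∈ e.component j)
    (hf : x ∈ f.component j) : e.component j = f.component j := by
  rw [e.component_eq_of_mem he, f.component_eq_of_mem hf]

theorem ext_component {e f : TopEnd K} (h : ∀ j, e.component j = f.component j) : e = f := by
  cases e
  cases f
  congr
  exact funext h

/-- Adding a limit point to a connected set keeps it connected, so components are relatively closed.
They need not be open, as `C` is not assumed locally connected. -/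
theorem closure_component_inter_subset (e : TopEnd K) (j : ℕ) :
    closure (e.component j) ∩ (K j)ᶜ ⊆ e.component j := by
  rintro p ⟨hp, hpK⟩
  obtain ⟨x, hx⟩ := e.component_nonempty j
  have hpre : IsPreconnected (e.component j) := by
    rw [e.component_eq_of_mem hx]
    exact isPreconnected_connectedComponentIn
  have h1 : IsPreconnected (insert p (e.component j)) :=
    hpre.subset_closure (subset_insert _ _) (insert_subset hp subset_closure)
  have h2 := h1.subset_connectedComponentIn (mem_insert_of_mem p hx)
    (insert_subset hpK (e.component_subset_compl j))
  rw [← e.component_eq_of_mem hx] at h2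
  exact h2 (mem_insert _ _)

theorem closure_component_succ_subset (e : TopEnd K) (j : ℕ) :
    closure (e.component (j + 1)) ⊆ e.component j := by
  intro p hp
  refine e.closure_component_inter_subset j ⟨closure_mono (e.antitone j) hp, fun hpK => ?_⟩
  have h1 := closure_mono (e.component_subset_compl (j + 1)) hp
  rw [closure_compl] at h1
  exact h1 (K.subset_interior_succ j hpK)

theorem basicNhd_antitone (e : TopEnd K) : Antitone e.basicNhd := fun _ _ hij =>
  union_subset_union (image_mono (e.component_antitone hij))
    (image_mono fun _ hf i hi => hf i (hi.trans hij))

end TopEnd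

namespace EndCompactification

/-- Only open sets are described: the sets `basicNhd` need not be neighbourhoods of their end. -/
theorem isOpen_iff {U : Set (EndCompactification K)} :
    IsOpen U ↔ IsOpen (point ⁻¹' U) ∧ ∀ e, atEnd e ∈ U → ∃ j, e.basicNhd j ⊆ U := by
  have hend : ∀ e : TopEnd K, U ∈ nhdFilter (atEnd e) ↔ ∃ j, e.basicNhd j ⊆ U := by
    intro e
    have := (hasBasis_iInf_principal (s := e.basicNhd)
      (directed_of_isDirected_le e.basicNhd_antitone)).mem_iff (t := U)
    simpa [nhdFilter] using this
  change (∀ a ∈ U, U ∈ nhdFilter a) ↔ _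
  constructor
  · exact fun h => ⟨isOpen_iff_mem_nhds.2 fun x hx => h (point x) hx,
      fun e he => (hend e).1 (h _ he)⟩
  · rintro ⟨h1, h2⟩ (x | e) ha
    · exact h1.mem_nhds ha
    · exact (hend e).2 (h2 e ha)

theorem point_injective : Function.Injective (point : C → EndCompactification K) :=
  fun _ _ h => by injection h

theorem isOpenEmbedding_point : IsOpenEmbedding (point : C → EndCompactification K) := by
  refine .of_continuous_injective_isOpenMap ⟨fun U hU => (isOpen_iff.1 hU).1⟩
    point_injective fun V hV => isOpen_iff.2 ⟨?_, ?_⟩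
  · rwa [preimage_image_eq _ point_injective]
  · rintro e ⟨x, -, hx⟩
    cases hx

theorem tendsto_point_iff {α : Type*} {l : Filter α} {u : α → C} {x : C} :
    Tendsto (fun n => (point (u n) : EndCompactification K)) l (𝓝 (point x)) ↔
      Tendsto u l (𝓝 x) :=
  isOpenEmbedding_point.toIsEmbedding.tendsto_nhds_iff.symm

variable [T2Space C]

theorem eventually_notMem_of_tendsto_atEnd {α : Type*} {l : Filter α} {u : α → C} {e : TopEnd K}
    (h : Tendsto (fun n => point (u n)) l (𝓝 (atEnd e))) (j : ℕ) : ∀ᶠ n in l, u n ∉ K j := by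
  have hopen : IsOpen ((point '' (K j))ᶜ : Set (EndCompactification K)) := by
    refine isOpen_iff.2 ⟨?_, fun f _ => ⟨j, ?_⟩⟩
    · rw [preimage_compl, preimage_image_eq _ point_injective]
      exact (K.isCompact j).isClosed.isOpen_compl
    · rintro _ (⟨x, hx, rfl⟩ | ⟨g, -, rfl⟩) ⟨y, hy, hxy⟩
      · cases hxy
        exact f.component_subset_compl j hx hy
      · cases hxy
  filter_upwards [h.eventually (hopen.mem_nhds (x := atEnd e) (by rintro ⟨_, _, h⟩; cases h))]
    with n hn hnK
  exact hn ⟨_, hnK, rfl⟩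

/-- The terms outside `e.component j` form a closed set because the sequence leaves every compact
set. Removing them leaves an open neighbourhood of `e`, so there are only finitely many such
indices. -/
theorem tendsto_atEnd_iff {u : ℕ → C} {e : TopEnd K} :
    Tendsto (fun n => point (u n)) atTop (𝓝 (atEnd e)) ↔
      ∀ j, ∀ᶠ n in atTop, u n ∈ e.component j := by
  constructor
  · intro h j
    let s : ℕ → Set C := fun n => {x | x = u n ∧ x ∉ e.component j}
    have hs : LocallyFinite s := by
      intro x
      obtain ⟨i, hi⟩ := K.exists_mem_nhds x
      refine ⟨K i, hi, ?_⟩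
      have h1 := eventually_notMem_of_tendsto_atEnd h i
      rw [← Nat.cofinite_eq_atTop] at h1
      refine Set.Finite.subset h1 ?_
      rintro n ⟨y, ⟨rfl, -⟩, hy⟩
      exact fun h => h hy
    have hcl : IsClosed (⋃ n, s n) := hs.isClosed_iUnion fun n =>
      (Set.Finite.subset (finite_singleton (u n)) fun x hx => hx.1).isClosed
    -- The complement of the bad terms, together with the ends that have a component free of them.
    let U : Set (EndCompactification K) :=
      {p | (∀ x, p = point x → x ∉ ⋃ n, s n) ∧
        ∀ f, p = atEnd f → ∃ i, Disjoint (f.component i) (⋃ n, s n)}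
    have hU : IsOpen U := by
      refine isOpen_iff.2 ⟨?_, ?_⟩
      · convert hcl.isOpen_compl using 1
        ext x
        simp [U]
      · rintro f hf
        obtain ⟨i, hi⟩ := hf.2 f rfl
        refine ⟨i, ?_⟩
        rintro _ (⟨x, hx, rfl⟩ | ⟨g, hg, rfl⟩)
        · refine ⟨fun y hy => ?_, fun g hg => by cases hg⟩
          cases hy
          exact hi.notMem_of_mem_left hx
        · refine ⟨fun y hy => (by cases hy), fun g' hg' => ?_⟩
          cases hg'
          exact ⟨i, by rwa [hg i le_rfl]⟩
    have heU : atEnd e ∈ U := by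
      refine ⟨fun y hy => (by cases hy), fun g hg => ?_⟩
      cases hg
      refine ⟨j, disjoint_left.2 fun x hx hx' => ?_⟩
      obtain ⟨n, -, hn⟩ := mem_iUnion.1 hx'
      exact hn hx
    filter_upwards [h.eventually (hU.mem_nhds heU)] with n hn
    by_contra hcon
    exact hn.1 _ rfl (mem_iUnion.2 ⟨n, rfl, hcon⟩)
  · intro h
    rw [tendsto_nhds]
    intro U hU he
    obtain ⟨j, hj⟩ := (isOpen_iff.1 hU).2 e he
    filter_upwards [h j] with n hn
    exact hj (.inl ⟨_, hn, rfl⟩)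

/-- A sequence of points of `C` has at most one limit in the end compactification. -/
theorem tendsto_point_unique {u : ℕ → C} {p q : EndCompactification K}
    (hp : Tendsto (fun n => point (u n)) atTop (𝓝 p))
    (hq : Tendsto (fun n => point (u n)) atTop (𝓝 q)) : p = q := by
  have key : ∀ {x : C} {e : TopEnd K}, Tendsto (fun n => point (u n)) atTop (𝓝 (atEnd e)) →
      ¬ Tendsto (fun n => (point (u n) : EndCompactification K)) atTop (𝓝 (point x)) := by
    intro x e he hx
    obtain ⟨j, hj⟩ := K.exists_mem_nhds x
    obtain ⟨n, hn, hn'⟩ := ((eventually_notMem_of_tendsto_atEnd he j).and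
      ((tendsto_point_iff.1 hx).eventually hj)).exists
    exact hn hn'
  cases p with
  | point x =>
    cases q with
    | point y => rw [tendsto_nhds_unique (tendsto_point_iff.1 hp) (tendsto_point_iff.1 hq)]
    | atEnd f => exact (key hq hp).elim
  | atEnd e =>
    cases q with
    | point y => exact (key hp hq).elim
    | atEnd f =>
      congr 1
      refine TopEnd.ext_component fun j => ?_
      obtain ⟨n, hn, hn'⟩ := ((tendsto_atEnd_iff.1 hp j).and (tendsto_atEnd_iff.1 hq j)).exists
      exact TopEnd.component_eq_of_mem_of_mem hn hn'

/-- If the end compactification is sequentially compact, then only finitely many components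
of `(K j)ᶜ` leave a sufficiently large compact set. -/
theorem exists_finite_components [SeqCompactSpace (EndCompactification K)] (j : ℕ) :
    ∃ i, (connectedComponentIn (K j)ᶜ '' (K i)ᶜ).Finite := by
  by_contra! hinf
  -- Greedy choice of points that leave every compact set and lie in pairwise distinct components.
  -- No subsequence converges: a limit in `C` contradicts the escape, and an end would put almost
  -- all terms in one component.
  obtain ⟨f, hf, hf'⟩ := exists_seq_of_forall_finset_exists
    (P := fun p : ℕ × C => p.2 ∉ K p.1)
    (r := fun p q => p.1 < q.1 ∧ connectedComponentIn (K j)ᶜ p.2 ≠ connectedComponentIn (K j)ᶜ q.2)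
    (by
      intro s _
      classical
      obtain ⟨i, hi⟩ : ∃ i, ∀ p ∈ s, p.1 < i := by
        refine ⟨s.sup Prod.fst + 1, fun p hp => Nat.lt_succ_of_le (Finset.le_sup hp)⟩
      obtain ⟨_, ⟨x, hx, rfl⟩, hx'⟩ := (hinf i).exists_notMem_finset
        (s.image fun p => connectedComponentIn (K j)ᶜ p.2)
      refine ⟨(i, x), hx, fun p hp => ⟨hi p hp, fun h => hx' ?_⟩⟩
      exact Finset.mem_image.2 ⟨p, hp, h⟩)
  obtain ⟨p, φ, hφ, hp⟩ := SeqCompactSpace.tendsto_subseq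
    (fun n => (point (f n).2 : EndCompactification K))
  have hmono : StrictMono fun n => (f n).1 :=
    strictMono_nat_of_lt_succ fun n => (hf' _ _ n.lt_succ_self).1
  have hesc : ∀ i, ∀ᶠ n in atTop, (f (φ n)).2 ∉ K i := by
    intro i
    filter_upwards [eventually_ge_atTop i] with n hn h
    exact hf (φ n) (K.subset (hn.trans ((hφ.id_le n).trans (hmono.id_le _))) h)
  cases p with
  | point x =>
    obtain ⟨i, hi⟩ := K.exists_mem_nhds x
    obtain ⟨n, hn, hn'⟩ := ((hesc i).and ((tendsto_point_iff.1 hp).eventually hi)).exists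
    exact hn hn'
  | atEnd e =>
    obtain ⟨N, hN⟩ := eventually_atTop.1 (tendsto_atEnd_iff.1 hp j)
    refine (hf' _ _ (hφ N.lt_succ_self)).2 ?_
    rw [← e.component_eq_of_mem (hN N le_rfl), ← e.component_eq_of_mem (hN _ N.le_succ)]

/-- Though perhaps not open, the component contains a nonempty open set: far out it competes with
finitely many components, whose closures can all be removed. -/
theorem component_inter_dense_nonempty [SeqCompactSpace (EndCompactification K)] {D : Set C}
    (hD : Dense D) (e : TopEnd K) (j : ℕ) : (e.component j ∩ D).Nonempty := by
  obtain ⟨i, hi⟩ := exists_finite_components (K := K) j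
  set k := max i j
  let T : Set (Set C) := {G ∈ connectedComponentIn (K j)ᶜ '' (K i)ᶜ | G ≠ e.component j}
  have hT : T.Finite := hi.subset fun _ h => h.1
  obtain ⟨p, hp⟩ := e.component_nonempty k
  have hpk := e.component_subset_compl k hp
  have hpj := e.component_antitone (le_max_right i j) hp
  have hclosed : IsClosed (⋃ G ∈ T, closure G) := hT.isClosed_biUnion fun _ _ => isClosed_closure
  have hpT : p ∉ ⋃ G ∈ T, closure G := by
    intro h
    obtain ⟨G, ⟨⟨x, hx, rfl⟩, hne⟩, hpG⟩ := mem_iUnion₂.1 h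
    have hxj : x ∈ (K j)ᶜ := by
      by_contra hxj
      simp [connectedComponentIn_eq_empty hxj] at hpG
    have h1 : IsPreconnected (insert p (connectedComponentIn (K j)ᶜ x)) :=
      isPreconnected_connectedComponentIn.subset_closure (subset_insert _ _)
        (insert_subset hpG subset_closure)
    have h2 := h1.subset_connectedComponentIn
      (mem_insert_of_mem p (mem_connectedComponentIn hxj))
      (insert_subset (e.component_subset_compl j hpj) (connectedComponentIn_subset _ _))
      (mem_insert _ _)
    exact hne ((connectedComponentIn_eq h2).trans (e.component_eq_of_mem hpj).symm)
  obtain ⟨q, ⟨hqk, hqT⟩, hqD⟩ := hD.inter_open_nonempty _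
    ((K.isCompact k).isClosed.isOpen_compl.inter hclosed.isOpen_compl) ⟨p, hpk, hpT⟩
  have hqj : q ∈ connectedComponentIn (K j)ᶜ q :=
    mem_connectedComponentIn fun h => hqk (K.subset (le_max_right i j) h)
  refine ⟨q, ?_, hqD⟩
  by_contra hcon
  refine hqT (mem_iUnion₂.2 ⟨connectedComponentIn (K j)ᶜ q,
    ⟨⟨q, fun h => hqk (K.subset (le_max_left i j) h), rfl⟩, fun h => hcon (h ▸ hqj)⟩,
    subset_closure hqj⟩)

/-- If the end compactification is sequentially compact, then the points of a dense subset of `C`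
are sequentially dense in it. -/
theorem exists_seq_tendsto_of_dense [FirstCountableTopology C]
    [SeqCompactSpace (EndCompactification K)] {D : Set C} (hD : Dense D)
    (p : EndCompactification K) :
    ∃ u : ℕ → C, (∀ n, u n ∈ D) ∧ Tendsto (fun n => point (u n)) atTop (𝓝 p) := by
  cases p with
  | point x =>
    obtain ⟨u, hu, hux⟩ := mem_closure_iff_seq_limit.1 (hD x)
    exact ⟨u, hu, tendsto_point_iff.2 hux⟩
  | atEnd e =>
    choose u hu huD using component_inter_dense_nonempty hD e
    refine ⟨u, huD, tendsto_atEnd_iff.2 fun j => ?_⟩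
    filter_upwards [eventually_ge_atTop j] with n hn
    exact e.component_antitone hn (hu n)

/-- A form of regularity of the end compactification for sequences of points of `C`. -/
theorem exists_subset_forall_tendsto [LocallyCompactSpace C] {p : EndCompactification K}
    {U : Set (EndCompactification K)} (hU : IsOpen U) (hp : p ∈ U) :
    ∃ B : Set C,
      (∀ u : ℕ → C, Tendsto (fun n => point (u n)) atTop (𝓝 p) → ∀ᶠ n in atTop, u n ∈ B) ∧
      ∀ (u : ℕ → C) (q : EndCompactification K), (∀ᶠ n in atTop, u n ∈ B) →
        Tendsto (fun n => point (u n)) atTop (𝓝 q) → q ∈ U := by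
  rw [isOpen_iff] at hU
  cases p with
  | point x =>
    obtain ⟨B, hB, hBU, hBc⟩ := local_compact_nhds (hU.1.mem_nhds hp)
    refine ⟨B, fun u hu => (tendsto_point_iff.1 hu).eventually hB, fun u q hu hq => ?_⟩
    cases q with
    | point y => exact hBU (hBc.isClosed.mem_of_tendsto (tendsto_point_iff.1 hq) hu)
    | atEnd f =>
      obtain ⟨j, hj⟩ := K.exists_superset_of_isCompact hBc
      obtain ⟨n, hn, hn'⟩ := ((eventually_notMem_of_tendsto_atEnd hq j).and hu).exists
      exact (hn (hj hn')).elim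
  | atEnd e =>
    -- The next index `j + 1` is used for `B` because the closure of that component stays in
    -- component `j`.
    obtain ⟨j, hj⟩ := hU.2 e hp
    refine ⟨e.component (j + 1), fun u hu => tendsto_atEnd_iff.1 hu _, fun u q hu hq => hj ?_⟩
    cases q with
    | point y =>
      exact .inl ⟨y, e.closure_component_succ_subset j
        (mem_closure_of_tendsto (tendsto_point_iff.1 hq) hu), rfl⟩
    | atEnd f =>
      refine .inr ⟨f, fun i hi => ?_, rfl⟩
      obtain ⟨n, hn, hn'⟩ := ((tendsto_atEnd_iff.1 hq i).and hu).exists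
      exact TopEnd.component_eq_of_mem_of_mem hn (e.component_antitone (by omega) hn')

end EndCompactification

open EndCompactification in
/-- A dense embedding of `Ω` into a sequentially compact Hausdorff space `M` dominates the end
compactification of `C` if and only if the fibers over distinct boundary points are disjoint. -/
theorem exists_continuous_surjective_iff_disjoint_fibers {Ω M : Type*} [TopologicalSpace Ω]
    [TopologicalSpace M] [T2Space M] [FrechetUrysohnSpace M] [SeqCompactSpace M] [T2Space C]
    [FirstCountableTopology C] [LocallyCompactSpace C] [SeqCompactSpace (EndCompactification K)]
    {ι : Ω → M} (hι : IsEmbedding ι) (hιd : DenseRange ι)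
    {j : Ω → C} (hj : IsEmbedding j) (hjd : DenseRange j) :
    (∃ F : M → EndCompactification K, Continuous F ∧ Function.Surjective F ∧
        ∀ z, F (ι z) = point (j z)) ↔
      ∀ x ∉ range fun z => (point (j z) : EndCompactification K),
        ∀ y ∉ range fun z => (point (j z) : EndCompactification K), x ≠ y →
        ∀ ξ ∉ range ι, ∀ u v : ℕ → Ω,
          Tendsto (fun n => point (j (u n))) atTop (𝓝 x) → Tendsto (ι ∘ u) atTop (𝓝 ξ) →
          Tendsto (fun n => point (j (v n))) atTop (𝓝 y) → ¬ Tendsto (ι ∘ v) atTop (𝓝 ξ) := by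
  have hjt : ∀ {u : ℕ → Ω} {z : Ω}, Tendsto (ι ∘ u) atTop (𝓝 (ι z)) →
      Tendsto (fun n => (point (j (u n)) : EndCompactification K)) atTop (𝓝 (point (j z))) :=
    fun h => tendsto_point_iff.2 ((hj.continuous.tendsto _).comp (hι.tendsto_nhds_iff.2 h))
  constructor
  · rintro ⟨F, hF, -, hFι⟩ x - y - hxy ξ - u v hux huξ hvy hvξ
    have key : ∀ {w : ℕ → Ω} {p : EndCompactification K},
        Tendsto (fun n => point (j (w n))) atTop (𝓝 p) → Tendsto (ι ∘ w) atTop (𝓝 ξ) →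
        p = F ξ := by
      intro w p hw hwξ
      refine tendsto_point_unique hw ?_
      simpa [Function.comp_def, hFι] using (hF.tendsto ξ).comp hwξ
    exact hxy ((key hux huξ).trans (key hvy hvξ).symm)
  · intro H
    have hlim : ∀ {u : ℕ → Ω} {p : EndCompactification K} {ξ : M}, ξ ∉ range ι →
        Tendsto (fun n => point (j (u n))) atTop (𝓝 p) → Tendsto (ι ∘ u) atTop (𝓝 ξ) →
        p ∉ range fun z => (point (j z) : EndCompactification K) := by
      rintro u _ ξ hξ hu huξ ⟨z, rfl⟩
      have h1 : Tendsto (ι ∘ u) atTop (𝓝 (ι z)) :=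
        hι.tendsto_nhds_iff.1 (hj.tendsto_nhds_iff.2 (tendsto_point_iff.1 hu))
      exact hξ ⟨z, tendsto_nhds_unique h1 huξ⟩
    have hex : ∀ ξ : M, ∃ (p : EndCompactification K) (u : ℕ → Ω),
        Tendsto (fun n => point (j (u n))) atTop (𝓝 p) ∧ Tendsto (ι ∘ u) atTop (𝓝 ξ) := by
      intro ξ
      obtain ⟨w, hw, hwξ⟩ := mem_closure_iff_seq_limit.1 (hιd ξ)
      choose u hu using hw
      obtain rfl : ι ∘ u = w := funext hu
      obtain ⟨p, φ, hφ, hp⟩ := SeqCompactSpace.tendsto_subseq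
        (fun n => (point (j (u n)) : EndCompactification K))
      exact ⟨p, u ∘ φ, hp, hwξ.comp hφ.tendsto_atTop⟩
    choose F hF using hex
    have huniq : ∀ {u : ℕ → Ω} {p : EndCompactification K} {ξ : M},
        Tendsto (fun n => point (j (u n))) atTop (𝓝 p) → Tendsto (ι ∘ u) atTop (𝓝 ξ) →
        p = F ξ := by
      intro u p ξ hu huξ
      obtain ⟨v, hv, hvξ⟩ := hF ξ
      by_cases hξ : ξ ∈ range ι
      · obtain ⟨z, rfl⟩ := hξ
        exact (tendsto_point_unique hu (hjt huξ)).trans (tendsto_point_unique (hjt hvξ) hv)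
      · by_contra hne
        exact H _ (hlim hξ hu huξ) _ (hlim hξ hv hvξ) hne ξ hξ u v hu huξ hv hvξ
    refine ⟨F, ?_, ?_, ?_⟩
    · rw [continuous_iff_continuousAt]
      intro ξ
      rw [ContinuousAt, tendsto_nhds]
      intro U hU hξU
      obtain ⟨B, hB, hB'⟩ := exists_subset_forall_tendsto hU hξU
      -- Otherwise a sequence avoiding `B` would tend to `ξ`, and a subsequence of it to `F ξ`,
      -- hence would enter `B`.
      have hξ : ξ ∉ closure (ι '' {z | j z ∉ B}) := by
        intro h
        obtain ⟨w, hw, hwξ⟩ := mem_closure_iff_seq_limit.1 h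
        choose u huB hu using hw
        obtain rfl : ι ∘ u = w := funext hu
        obtain ⟨p, φ, hφ, hp⟩ := SeqCompactSpace.tendsto_subseq
          (fun n => (point (j (u n)) : EndCompactification K))
        obtain rfl := huniq hp (hwξ.comp hφ.tendsto_atTop)
        obtain ⟨n, hn⟩ := (hB _ hp).exists
        exact huB _ hn
      filter_upwards [isClosed_closure.isOpen_compl.mem_nhds hξ] with η hη
      obtain ⟨u, hu, huη⟩ := hF η
      refine hB' _ _ ?_ hu
      filter_upwards [huη.eventually (isClosed_closure.isOpen_compl.mem_nhds hη)] with n hn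
      by_contra hcon
      exact hn (subset_closure ⟨_, hcon, rfl⟩)
    · intro p
      obtain ⟨w, hw, hwp⟩ := exists_seq_tendsto_of_dense hjd p
      choose u hu using hw
      obtain rfl : (fun n => j (u n)) = w := funext hu
      obtain ⟨ξ, φ, hφ, hξ⟩ := SeqCompactSpace.tendsto_subseq (ι ∘ u)
      exact ⟨ξ, (huniq (hwp.comp hφ.tendsto_atTop) hξ).symm⟩
    · intro z
      exact (huniq (u := fun _ => z) tendsto_const_nhds tendsto_const_nhds).symm

end Ends

/-! ### Compactness and metrizability of the metric compactification -/

section MetricCompactification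

variable {X : Type*} [MetricSpace X]

/-- The difference of the values at two points, as a function on `FunctionsModConst X`. -/
def FunctionsModConst.evalSub (x y : X) : FunctionsModConst X → ℝ :=
  Quotient.lift (fun f : C(X, ℝ) => f x - f y) (by
    intro f g h
    obtain ⟨c, hc⟩ := (Submodule.quotientRel_def _).1 h
    have hx := DFunLike.congr_fun hc x
    have hy := DFunLike.congr_fun hc y
    simp only [ContinuousMap.sub_apply, ContinuousMap.const_apply] at hx hy
    change f x - f y = g x - g y
    linarith)

namespace FunctionsModConst

theorem continuous_mk :
    Continuous (Submodule.Quotient.mk : C(X, ℝ) → FunctionsModConst X) :=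
  continuous_quot_mk

theorem continuous_evalSub (x y : X) : Continuous (evalSub x y) :=
  continuous_quot_lift _ (by fun_prop)

theorem evalSub_distClass (x y z : X) : evalSub x y (distClass z) = dist z x - dist z y := rfl

/-- A continuous function modulo constants is determined by its differences on a dense set. All of
`X` gives Hausdorffness; a dense sequence gives metrizability. -/
theorem injective_evalSub_of_denseRange {ι : Type*} {d : ι → X} (hd : DenseRange d) (x₀ : X) :
    Function.Injective fun (F : FunctionsModConst X) i => evalSub (d i) x₀ F := by
  intro F G h
  obtain ⟨f, rfl⟩ := Submodule.Quotient.mk_surjective _ F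
  obtain ⟨g, rfl⟩ := Submodule.Quotient.mk_surjective _ G
  have h1 : (fun z => f z - f x₀) = fun z => g z - g x₀ :=
    hd.equalizer (by fun_prop) (by fun_prop) h
  refine (Submodule.Quotient.eq _).2 ⟨f x₀ - g x₀, ?_⟩
  ext z
  have := congr_fun h1 z
  simp only [ContinuousMap.sub_apply, ContinuousMap.const_apply] at this ⊢
  linarith

instance t2Space : T2Space (FunctionsModConst X) := by
  rcases isEmpty_or_nonempty X with hX | ⟨⟨x₀⟩⟩
  · have : Subsingleton (FunctionsModConst X) :=
      (Submodule.Quotient.mk_surjective (constFunctions X)).subsingleton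
    infer_instance
  · exact T2Space.of_injective_continuous (injective_evalSub_of_denseRange denseRange_id x₀)
      (continuous_pi fun i => continuous_evalSub _ _)

end FunctionsModConst

open FunctionsModConst

/-- The Lipschitz bound gives equicontinuity, and the value zero at `x₀` bounds every other value,
so Arzelà–Ascoli applies without properness of `X`. -/
theorem isCompact_lipschitzWith_eq_zero (x₀ : X) :
    IsCompact {f : C(X, ℝ) | LipschitzWith 1 f ∧ f x₀ = 0} := by
  refine ArzelaAscoli.isCompact_of_equicontinuous _ ?_ ?_
  · have : ContinuousMap.toFun '' {f : C(X, ℝ) | LipschitzWith 1 f ∧ f x₀ = 0} =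
        {f : X → ℝ | LipschitzWith 1 f ∧ f x₀ = 0} := by
      ext f
      exact ⟨fun ⟨g, hg, h⟩ => h ▸ hg, fun h => ⟨⟨f, h.1.continuous⟩, h, rfl⟩⟩
    rw [this]
    refine (isCompact_univ_pi fun x => isCompact_Icc (a := -dist x x₀)
      (b := dist x x₀)).of_isClosed_subset ?_ ?_
    · simp only [lipschitzWith_iff_dist_le_mul, ofPred_and, ofPred_forall]
      refine (isClosed_iInter fun x => isClosed_iInter fun y => isClosed_le ?_ ?_).inter
        (isClosed_eq ?_ ?_) <;> fun_prop
    · rintro f ⟨hf, hf0⟩ x -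
      have := hf.dist_le_mul x x₀
      rw [hf0, Real.dist_eq, sub_zero, NNReal.coe_one, one_mul] at this
      exact abs_le.1 this
  · refine Metric.equicontinuous_of_continuity_modulus id tendsto_id _ ?_
    rintro x y ⟨f, hf, -⟩
    simpa using hf.dist_le_mul x y

theorem isCompact_closure_range_distClass :
    IsCompact (closure (range (distClass : X → FunctionsModConst X))) := by
  rcases isEmpty_or_nonempty X with hX | ⟨⟨x₀⟩⟩
  · simp [range_eq_empty]
  · refine ((isCompact_lipschitzWith_eq_zero x₀).image continuous_mk).closure_of_subset ?_
    rintro _ ⟨x, rfl⟩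
    -- Each class has this normalized 1-Lipschitz representative.
    refine ⟨⟨fun z => dist x z - dist x x₀, by fun_prop⟩, ⟨?_, by simp⟩, ?_⟩
    · refine LipschitzWith.of_dist_le_mul fun y z => ?_
      simpa [Real.dist_eq, dist_comm x] using abs_dist_sub_le y z x
    · refine (Submodule.Quotient.eq _).2 ⟨-dist x x₀, ?_⟩
      ext z
      simp

instance : CompactSpace (MetricCompactification X) :=
  isCompact_iff_compactSpace.1 isCompact_closure_range_distClass

theorem metrizableSpace_metricCompactification [TopologicalSpace.SeparableSpace X] :
    TopologicalSpace.MetrizableSpace (MetricCompactification X) := by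
  rcases isEmpty_or_nonempty X with hX | ⟨⟨x₀⟩⟩
  · have : IsEmpty (MetricCompactification X) := by simp [range_eq_empty, isEmpty_subtype]
    infer_instance
  · have hinj := (injective_evalSub_of_denseRange
      (@TopologicalSpace.denseRange_denseSeq X _ _ ⟨x₀⟩) x₀).comp
      (Subtype.val_injective (p := (· ∈ closure (range (distClass : X → FunctionsModConst X)))))
    have hcont : Continuous ((fun (F : FunctionsModConst X) i =>
        evalSub (@TopologicalSpace.denseSeq X _ _ ⟨x₀⟩ i) x₀ F) ∘ Subtype.val :
        MetricCompactification X → ℕ → ℝ) :=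
      (continuous_pi fun i => continuous_evalSub _ _).comp continuous_subtype_val
    exact (hcont.isClosedEmbedding hinj).isEmbedding.metrizableSpace

theorem continuous_metricEmbedding :
    Continuous (metricEmbedding : X → MetricCompactification X) :=
  (continuous_mk.comp
    (ContinuousMap.curry ⟨fun p : X × X => dist p.1 p.2, by fun_prop⟩).continuous).subtype_mk _

theorem injective_metricEmbedding :
    Function.Injective (metricEmbedding : X → MetricCompactification X) := by
  intro x y h
  have := congr_arg (fun ξ : MetricCompactification X => evalSub x y ξ.1) h
  simp only [metricEmbedding, evalSub_distClass, dist_self, dist_comm y x] at this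
  exact dist_eq_zero.1 (by linarith)

theorem denseRange_metricEmbedding :
    DenseRange (metricEmbedding : X → MetricCompactification X) := by
  have : range (metricEmbedding : X → MetricCompactification X) =
      Subtype.val ⁻¹' range (distClass : X → FunctionsModConst X) := by
    ext ξ
    simp [metricEmbedding, Subtype.ext_iff]
  rw [DenseRange, this, Subtype.dense_iff, Subtype.image_preimage_coe,
    inter_eq_right.2 subset_closure]

theorem tendsto_dist_sub_dist {α : Type*} {l : Filter α} {u : α → X} {x : X}
    (h : Tendsto (fun n => metricEmbedding (u n)) l (𝓝 (metricEmbedding x))) (z : X) :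
    Tendsto (fun n => dist (u n) z - dist (u n) x) l (𝓝 (dist x z)) := by
  have := ((continuous_evalSub z x).comp continuous_subtype_val).tendsto (metricEmbedding x)
  simpa [Function.comp_def, metricEmbedding, evalSub_distClass] using this.comp h

end MetricCompactification

/-! ### Chains of discs -/

section Poincare

theorem poincareDist_zero_left (b : ℂ) : poincareDist 0 b = Real.artanh ‖b‖ := by
  simp [poincareDist]

theorem one_sub_conj_mul_ne_zero {a b : ℂ} (ha : ‖a‖ < 1) (hb : ‖b‖ < 1) : 1 - conj a * b ≠ 0 := by
  intro h
  have h1 : ‖conj a * b‖ = 1 := by rw [← sub_eq_zero.1 h, norm_one]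
  rw [norm_mul, Complex.norm_conj] at h1
  nlinarith [norm_nonneg a, norm_nonneg b]

theorem normSq_one_sub_conj_mul_sub (a b : ℂ) :
    Complex.normSq (1 - conj a * b) - Complex.normSq (a - b) =
      (1 - Complex.normSq a) * (1 - Complex.normSq b) := by
  simp only [Complex.normSq_apply, Complex.sub_re, Complex.sub_im, Complex.mul_re, Complex.mul_im,
    Complex.conj_re, Complex.conj_im, Complex.one_re, Complex.one_im]
  ring

theorem norm_sub_div_one_sub_conj_mul_lt_one {a b : ℂ} (ha : ‖a‖ < 1) (hb : ‖b‖ < 1) :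
    ‖(a - b) / (1 - conj a * b)‖ < 1 := by
  rw [norm_div, div_lt_one (norm_pos_iff.2 (one_sub_conj_mul_ne_zero ha hb))]
  refine lt_of_pow_lt_pow_left₀ 2 (norm_nonneg _) ?_
  have h := normSq_one_sub_conj_mul_sub a b
  simp only [Complex.normSq_eq_norm_sq] at h
  have : 0 < (1 - ‖a‖ ^ 2) * (1 - ‖b‖ ^ 2) :=
    mul_pos (by nlinarith [norm_nonneg a]) (by nlinarith [norm_nonneg b])
  linarith

/-- The points of a radius of the unit disc lie on a geodesic of the Poincaré distance. -/
theorem poincareDist_zero_add {c : ℂ} (hc : ‖c‖ < 1) {t : ℝ} (h0 : 0 ≤ t) (h1 : t ≤ 1) :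
    poincareDist 0 (t * c) + poincareDist (t * c) c = poincareDist 0 c := by
  set r := ‖c‖ with hr
  have hr0 : 0 ≤ r := norm_nonneg c
  have htr : 0 ≤ t * r := mul_nonneg h0 hr0
  have htr1 : t * r ≤ r := mul_le_of_le_one_left hr0 h1
  have hpos : 0 < 1 - t * r ^ 2 := by nlinarith
  have h2 : poincareDist (t * c) c = Real.artanh ((r - t * r) / (1 - t * r ^ 2)) := by
    unfold poincareDist
    congr 1
    have e1 : (t * c - c : ℂ) = ((t - 1 : ℝ) : ℂ) * c := by push_cast; ring
    have e2 : (1 - conj (t * c) * c : ℂ) = ((1 - t * r ^ 2 : ℝ) : ℂ) := by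
      rw [map_mul, Complex.conj_ofReal, mul_assoc, ← Complex.normSq_eq_conj_mul_self,
        Complex.normSq_eq_norm_sq]
      push_cast
      rfl
    rw [norm_div, e1, e2, norm_mul, Complex.norm_real, Complex.norm_real, Real.norm_eq_abs,
      Real.norm_eq_abs, abs_of_pos hpos, abs_of_nonpos (by linarith), ← hr]
    ring
  have hq0 : 0 ≤ (r - t * r) / (1 - t * r ^ 2) := div_nonneg (by linarith) hpos.le
  have hq1 : (r - t * r) / (1 - t * r ^ 2) < 1 := by
    rw [div_lt_one hpos]
    nlinarith
  have hn : ‖(t * c : ℂ)‖ = t * r := by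
    rw [norm_mul, Complex.norm_real, Real.norm_eq_abs, abs_of_nonneg h0]
  rw [h2, poincareDist_zero_left, poincareDist_zero_left, hn, ← hr,
    Real.artanh_eq_half_log ⟨by linarith, by linarith⟩,
    Real.artanh_eq_half_log ⟨by linarith, by linarith⟩,
    Real.artanh_eq_half_log ⟨by linarith, by linarith⟩, ← mul_add, ← Real.log_mul]
  · have e1 : 1 + (r - t * r) / (1 - t * r ^ 2) = (1 + r) * (1 - t * r) / (1 - t * r ^ 2) := by
      rw [eq_div_iff hpos.ne', add_mul, div_mul_cancel₀ _ hpos.ne']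
      ring
    have e2 : 1 - (r - t * r) / (1 - t * r ^ 2) = (1 - r) * (1 + t * r) / (1 - t * r ^ 2) := by
      rw [eq_div_iff hpos.ne', sub_mul, div_mul_cancel₀ _ hpos.ne']
      ring
    have h3 : 1 - t * r ≠ 0 := by linarith
    have h4 : 1 + t * r ≠ 0 := by linarith
    have h5 : 1 - r ≠ 0 := by linarith
    -- With $r=\|c\|$, the factors $1\pm tr$ cancel in the product of the two arguments, leaving
    -- $(1+r)/(1-r)$.
    rw [e1, e2, div_div_div_cancel_right₀ hpos.ne']
    congr 2
    field_simp
  · exact (div_pos (by linarith) (by linarith)).ne'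
  · exact (div_pos (by linarith) (by linarith)).ne'

end Poincare

section DiscChain

variable {E : Type*} [NormedAddCommGroup E] [NormedSpace ℂ E]
variable {M : Type*} [TopologicalSpace M] [ChartedSpace E M]

/-- Every link of a chain can be parametrized so that it starts at the centre of the disc. -/
theorem exists_disc_from_zero {f : ℂ → M} {a b : ℂ}
    (hf : MDifferentiableOn 𝓘(ℂ, ℂ) 𝓘(ℂ, E) f (Metric.ball (0 : ℂ) 1))
    (ha : a ∈ Metric.ball (0 : ℂ) 1) (hb : b ∈ Metric.ball (0 : ℂ) 1) :
    ∃ (g : ℂ → M) (c : ℂ), MDifferentiableOn 𝓘(ℂ, ℂ) 𝓘(ℂ, E) g (Metric.ball (0 : ℂ) 1) ∧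
      ‖c‖ < 1 ∧ g 0 = f a ∧ g c = f b ∧ poincareDist 0 c = poincareDist a b := by
  rw [mem_ball_zero_iff] at ha hb
  -- The automorphism of the disc that exchanges `0` and `a`; it is its own inverse.
  let φ : ℂ → ℂ := fun w => (a - w) / (1 - conj a * w)
  have hφ : ∀ w : ℂ, ‖w‖ < 1 → ‖φ w‖ < 1 := fun w hw =>
    norm_sub_div_one_sub_conj_mul_lt_one ha hw
  have hd : DifferentiableOn ℂ φ (Metric.ball 0 1) := by
    refine DifferentiableOn.div (by fun_prop) (by fun_prop) fun w hw => ?_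
    exact one_sub_conj_mul_ne_zero ha (mem_ball_zero_iff.1 hw)
  refine ⟨f ∘ φ, φ b, ?_, hφ b hb, by simp [φ], ?_, ?_⟩
  · exact hf.comp hd.mdifferentiableOn fun w hw => by
      simpa using hφ w (mem_ball_zero_iff.1 hw)
  · have hb' := one_sub_conj_mul_ne_zero ha hb
    have hab := one_sub_conj_mul_ne_zero ha (hφ b hb)
    change f (φ (φ b)) = f b
    congr 1
    rw [div_eq_iff hab]
    have key : φ b * (1 - conj a * b) = a - b := div_mul_cancel₀ _ hb'
    refine mul_right_cancel₀ hb' ?_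
    linear_combination (-1 + b * conj a) * key
  · rw [poincareDist_zero_left]
    rfl

/-- A chain of discs that enters a set crosses its frontier. -/
theorem DiscChain.exists_mem_frontier {x y : M} {r : ℝ} (h : DiscChain E y x r) {s : Set M}
    (hy : y ∉ s) (hx : x ∈ s) :
    ∃ z ∈ frontier s, ∃ r₁ r₂, DiscChain E y z r₁ ∧ DiscChain E z x r₂ ∧ r₁ + r₂ = r := by
  induction h with
  | nil => exact absurd hx hy
  | @cons y y' x r f a b hf ha hb hfa hfb h ih =>
    by_cases hy' : y' ∈ s
    · obtain ⟨g, c, hg, hc, hg0, hgc, hgd⟩ := exists_disc_from_zero hf ha hb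
      have hmem : ∀ t ∈ Icc (0 : ℝ) 1, (t * c : ℂ) ∈ Metric.ball (0 : ℂ) 1 := by
        rintro t ⟨h0, h1⟩
        rw [mem_ball_zero_iff, norm_mul, Complex.norm_real, Real.norm_eq_abs, abs_of_nonneg h0]
        nlinarith [norm_nonneg c]
      have hcont : ContinuousOn (fun t : ℝ => g (t * c)) (Icc 0 1) :=
        hg.continuousOn.comp (by fun_prop) hmem
      have hconn : IsPreconnected ((fun t : ℝ => g (t * c)) '' Icc 0 1) :=
        isPreconnected_Icc.image _ hcont
      obtain ⟨_, ⟨t, ht, rfl⟩, hts⟩ :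
          (((fun t : ℝ => g (t * c)) '' Icc 0 1) ∩ frontier s).Nonempty := by
        by_contra hcon
        rw [not_nonempty_iff_eq_empty] at hcon
        have hsub : (fun t : ℝ => g (t * c)) '' Icc 0 1 ⊆ interior s ∪ (closure s)ᶜ := by
          intro z hz
          by_contra hzz
          simp only [mem_union, mem_compl_iff, not_or, not_not] at hzz
          exact (hcon.subset ⟨hz, hzz.2, hzz.1⟩).elim
        obtain ⟨z, -, hz, hz'⟩ := hconn _ _ isOpen_interior isClosed_closure.isOpen_compl hsub
          ⟨y', ⟨1, by simp, by simp [hgc, hfb]⟩, by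
            rcases hsub ⟨1, by simp, rfl⟩ with h | h
            · simpa [hgc, hfb] using h
            · exact absurd (subset_closure hy') (by simpa [hgc, hfb] using h)⟩
          ⟨y, ⟨0, by simp, by simp [hg0, hfa]⟩, by
            rcases hsub ⟨0, by simp, rfl⟩ with h | h
            · exact absurd (interior_subset h) (by simpa [hg0, hfa] using hy)
            · simpa [hg0, hfa] using h⟩
        exact hz' (subset_closure (interior_subset hz))
      refine ⟨_, hts, _, _, .cons g 0 (t * c) hg (by simp) (hmem t ht) (hg0.trans hfa) rfl (.nil _),
        .cons g (t * c) c hg (hmem t ht) (by simpa using hc) rfl (hgc.trans hfb) h, ?_⟩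
      rw [add_zero, ← add_assoc, poincareDist_zero_add hc ht.1 ht.2, hgd]
    · obtain ⟨z, hz, r₁, r₂, h₁, h₂, hr⟩ := ih hy' hx
      exact ⟨z, hz, _, r₂, .cons f a b hf ha hb hfa hfb h₁, h₂, by rw [add_assoc, hr]⟩

end DiscChain

/-! ### The Kobayashi distance and the topology of the manifold -/

section KobayashiSpace

variable {E : Type*} [NormedAddCommGroup E] [NormedSpace ℂ E]
variable {M : Type*} [TopologicalSpace M] [ChartedSpace E M] [IsManifold 𝓘(ℂ, E) ω M]

theorem eventually_kobayashiDist_le (p : M) {ε : ℝ} (hε : 0 < ε) :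
    ∀ᶠ q in 𝓝 p, kobayashiDist E p q ≤ ε := by
  have : IsManifold 𝓘(ℂ, E) 1 M := .of_le (n := ω) le_top
  -- Chosen so that `poincareDist 0 s = ε`; the disc `g` below is affine in the chart and passes
  -- through `p` at `0` and `q` at `s`.
  set s := Real.tanh ε
  have hs0 : 0 < s := by
    rw [show s = _ from Real.tanh_eq_sinh_div_cosh ε]
    exact div_pos (Real.sinh_pos_iff.2 hε) (Real.cosh_pos ε)
  have hs1 : s < 1 := Real.tanh_lt_one ε
  set e := chartAt E p with he
  have hp : p ∈ e.source := mem_chart_source E p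
  have ht : e.target ∈ 𝓝 (e p) := e.open_target.mem_nhds (e.map_source hp)
  obtain ⟨R, hR, hRt⟩ := Metric.mem_nhds_iff.1 ht
  have hnear : ∀ᶠ q in 𝓝 p, e q ∈ Metric.ball (e p) (s * R) :=
    (e.continuousAt hp).eventually (Metric.ball_mem_nhds _ (mul_pos hs0 hR))
  filter_upwards [hnear, e.open_source.mem_nhds hp] with q hq hqs
  set g : ℂ → E := fun t => e p + (t / s) • (e q - e p) with hg
  have hsC : (s : ℂ) ≠ 0 := Complex.ofReal_ne_zero.2 hs0.ne'
  have hgball : ∀ t ∈ Metric.ball (0 : ℂ) 1, g t ∈ e.target := by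
    intro t htt
    apply hRt
    rw [mem_ball_iff_norm] at hq ⊢
    rw [mem_ball_zero_iff] at htt
    simp only [hg, add_sub_cancel_left, norm_smul, norm_div, Complex.norm_real, Real.norm_eq_abs,
      abs_of_pos hs0]
    rw [div_mul_eq_mul_div, div_lt_iff₀ hs0]
    nlinarith [norm_nonneg t, norm_nonneg (e q - e p)]
  have hgd : MDifferentiable 𝓘(ℂ, ℂ) 𝓘(ℂ, E) g := by
    rw [mdifferentiable_iff_differentiable]
    fun_prop
  have hsn : ‖(s : ℂ)‖ = s := by rw [Complex.norm_real, Real.norm_eq_abs, abs_of_pos hs0]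
  have hchain : DiscChain E p q (poincareDist 0 s + 0) :=
    .cons (fun t => e.symm (g t)) 0 s
      ((mdifferentiableOn_atlas_symm (chart_mem_atlas E p)).comp hgd.mdifferentiableOn hgball)
      (by simp) (by rwa [mem_ball_zero_iff, hsn]) (by simp [hg, e.left_inv hp])
      (by simp [hg, hsC, e.left_inv hqs]) (.nil _)
  have := kobayashiDist_le hchain
  rwa [poincareDist_zero_left, hsn, Real.artanh_tanh, add_zero] at this

variable [ConnectedSpace M] (h : KobayashiHyperbolic E M)

theorem continuous_toKobayashi : Continuous (toKobayashi h) := by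
  rw [continuous_iff_continuousAt]
  intro p
  rw [ContinuousAt, Metric.tendsto_nhds]
  intro ε hε
  filter_upwards [eventually_kobayashiDist_le (E := E) p (half_pos hε)] with q hq
  rw [dist_comm]
  exact lt_of_le_of_lt hq (half_lt_self hε)

theorem separableSpace_kobayashiSpace [SecondCountableTopology M] :
    TopologicalSpace.SeparableSpace (KobayashiSpace h) :=
  (Function.Surjective.denseRange (f := toKobayashi h) fun x => ⟨x, rfl⟩).separableSpace
    (continuous_toKobayashi h)

/-- Between a point outside `s` and a point of `s` there is a point of the frontier that lies
almost on a geodesic. -/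
theorem exists_mem_frontier_dist_add_lt {x y : M} {s : Set M} (hy : y ∉ s) (hx : x ∈ s) {η : ℝ}
    (hη : 0 < η) :
    ∃ z ∈ frontier s, dist (toKobayashi h y) (toKobayashi h z) +
      dist (toKobayashi h z) (toKobayashi h x) <
        dist (toKobayashi h y) (toKobayashi h x) + η := by
  obtain ⟨r, hr, hr'⟩ := Real.lt_sInf_add_pos (s := {r | DiscChain E y x r})
    (DiscChain.exists_of_connected y x) hη
  obtain ⟨z, hz, r₁, r₂, h₁, h₂, rfl⟩ := DiscChain.exists_mem_frontier hr hy hx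
  exact ⟨z, hz, (add_le_add (kobayashiDist_le h₁) (kobayashiDist_le h₂)).trans_lt hr'⟩

/-- A hyperbolic manifold is embedded in its metric compactification. -/
theorem isEmbedding_metricEmbedding_toKobayashi [T2Space M] [LocallyCompactSpace M] :
    IsEmbedding fun z : M => metricEmbedding (toKobayashi h z) := by
  have hcont := continuous_metricEmbedding.comp (continuous_toKobayashi h)
  refine ⟨isInducing_iff_nhds.2 fun x => le_antisymm (hcont.tendsto x).le_comap ?_,
    injective_metricEmbedding.comp fun _ _ hxy => hxy⟩
  intro W hW
  obtain ⟨s, hs, hsW, hsc⟩ := local_compact_nhds hW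
  have hxs : x ∉ frontier s := fun hx => hx.2 (mem_interior_iff_mem_nhds.2 hs)
  have hS : IsCompact (toKobayashi h '' frontier s) :=
    (hsc.of_isClosed_subset isClosed_frontier hsc.isClosed.frontier_subset).image
      (continuous_toKobayashi h)
  obtain ⟨δ, hδ, hδS⟩ : ∃ δ > 0, ∀ z ∈ frontier s,
      δ ≤ dist (toKobayashi h z) (toKobayashi h x) := by
    have hx : toKobayashi h x ∉ toKobayashi h '' frontier s := by
      rintro ⟨z, hz, hzx⟩
      obtain rfl : z = x := hzx
      exact hxs hz
    obtain ⟨δ, hδ, hd⟩ := Metric.isOpen_iff.1 hS.isClosed.isOpen_compl _ hx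
    refine ⟨δ, hδ, fun z hz => ?_⟩
    by_contra! hlt
    exact hd hlt ⟨z, hz, rfl⟩
  -- Convergence in the compactification controls each distance difference separately, so the
  -- frontier is replaced by a finite net.
  obtain ⟨t, htS, htf, hcover⟩ := hS.finite_cover_balls (e := δ / 4) (by positivity)
  have hlim : ∀ᶠ y in comap (fun z : M => metricEmbedding (toKobayashi h z))
      (𝓝 (metricEmbedding (toKobayashi h x))), ∀ z ∈ t, 3 * δ / 4 <
        dist (toKobayashi h y) z - dist (toKobayashi h y) (toKobayashi h x) := by
    refine (htf.eventually_all).2 fun z hz => ?_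
    refine (tendsto_dist_sub_dist tendsto_comap z).eventually_const_lt ?_
    obtain ⟨z', hz', rfl⟩ := htS hz
    have := hδS z' hz'
    rw [dist_comm] at this
    linarith
  filter_upwards [hlim] with y hy
  refine hsW ?_
  by_contra hys
  -- The crossing point `z` gives $d(y,z)-d(y,x)<\delta/4-\delta$. A net point within $\delta/4$ of
  -- `z` then has difference below $-\delta/2$, against the lower bound $3\delta/4$.
  obtain ⟨z, hz, hlt⟩ := exists_mem_frontier_dist_add_lt h hys (mem_of_mem_nhds hs)
    (by positivity : 0 < δ / 4)
  obtain ⟨z', hz', hzz'⟩ := mem_iUnion₂.1 (hcover ⟨z, hz, rfl⟩)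
  have h1 := hy z' hz'
  have h2 := hδS z hz
  have h3 := dist_triangle (toKobayashi h y) (toKobayashi h z) z'
  rw [Metric.mem_ball] at hzz'
  linarith

end KobayashiSpace

/-! ### Disjointness of fibers for hyperbolic domains -/

theorem theorem1p7
    {E : Type*} [NormedAddCommGroup E] [NormedSpace ℂ E] [FiniteDimensional ℂ E]
    {X : Type*} [TopologicalSpace X] [T2Space X] [SecondCountableTopology X]
    [ChartedSpace E X] [IsManifold 𝓘(ℂ, E) ω X]
    (Ω : TopologicalSpace.Opens X) [ConnectedSpace Ω] (hΩ : Ω ≠ ⊤)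
    (hyp : KobayashiHyperbolic E Ω)
    (K : CompactExhaustion (closure (Ω : Set X)))
    (hseq : SeqCompactSpace (EndCompactification K)) :
    (∃ F : MetricCompactification (KobayashiSpace hyp) → EndCompactification K,
        Continuous F ∧ Function.Surjective F ∧
        ∀ z : Ω, F (kobayashiEmbedding hyp z) = endInclusion K z) ↔
      ∀ x ∈ endBoundary K, ∀ y ∈ endBoundary K, x ≠ y →
        metricFiber hyp K x ∩ metricFiber hyp K y = ∅ := by
  have : LocallyCompactSpace X := Manifold.locallyCompact_of_finiteDimensional 𝓘(ℂ, E)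
  have : LocallyCompactSpace Ω := Ω.isOpen.locallyCompactSpace
  have : LocallyCompactSpace (closure (Ω : Set X)) := isClosed_closure.locallyCompactSpace
  have := separableSpace_kobayashiSpace hyp
  -- Metrizability turns compactness into sequential compactness and lets sequences compute
  -- closures.
  have := metrizableSpace_metricCompactification (X := KobayashiSpace hyp)
  have hι := isEmbedding_metricEmbedding_toKobayashi hyp
  have hιd : DenseRange fun z : Ω => metricEmbedding (toKobayashi hyp z) :=
    denseRange_metricEmbedding (X := KobayashiSpace hyp)
  let j : Ω → closure (Ω : Set X) := fun z => ⟨z, subset_closure z.2⟩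
  have hj : IsEmbedding j := .inclusion subset_closure
  have hjd : DenseRange j := by
    have hr : range j = Subtype.val ⁻¹' (Ω : Set X) := by
      ext z
      simp [j, Subtype.ext_iff]
    rw [DenseRange, hr, Subtype.dense_iff, Subtype.image_preimage_coe,
      inter_eq_right.2 subset_closure]
  refine (exists_continuous_surjective_iff_disjoint_fibers (K := K) hι hιd hj hjd).trans ?_
  refine forall₂_congr fun x _ => forall₂_congr fun y _ => imp_congr_right fun _ => ?_
  rw [eq_empty_iff_forall_notMem]
  constructor
  · rintro H ξ ⟨⟨hξ, u, hux, huξ⟩, -, v, hvy, hvξ⟩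
    exact H ξ hξ u v hux huξ hvy hvξ
  · intro H ξ hξ u v hux huξ hvy hvξ
    exact H ξ ⟨⟨hξ, u, hux, huξ⟩, hξ, v, hvy, hvξ⟩
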